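/- A metric space is called *ultrahomogeneous* if every isometry between two of its compact subsets extends to an isometry of the whole space onto itself, *universal* if it contains an isometric copy of every separable metric space, and *Polish* if it is separable and admits a compatible complete metric. Let $\mathbb U$ be a Urysohn universal space, that is, an ultrahomogeneous, universal, Polish metric space. Let $\mathcal{DS}(\mathbb U)$ be the set of nonempty compact sets $f\subseteq\mathbb U\times\mathbb U$ with $\pi_1(f)=\pi_2(f)=:M(f)$, and let $D$ be the Hausdorff distance on it induced by the max-metric on $\mathbb U\times\mathbb U$. Write $f\sim g$ if there is an isometry $\varphi$ of $M(f)$ onto $M(g)$ such that $(x,y)\in f\iff(\varphi(x),\varphi(y))\in g$ for all $x,y\in M(f)$; let $\mathcal{DS}_{\mathrm{Iso}}(\mathbb U)=\mathcal{DS}(\mathbb U)/{\sim}$, denote by $\tilde f$ the class of $f$, and put $$\tilde D(\tilde f,\tilde g)=\inf\{D(f',g'):f'\sim f,\ g'\sim g\}.$$ Let $\mathcal C\subseteq\mathcal{DS}_{\mathrm{Iso}}(\mathbb U)$ be the set of classes of those $f$ that are graphs of continuous maps $M(f)\to M(f)$. For compact metric spaces $X,Y$ and $\epsilon>0$, an $\epsilon$-isometry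 from $X$ to $Y$ is a (not necessarily continuous) function $\varphi:X\to Y$ with $|d(\varphi(x),\varphi(x'))-d(x,x')|<\epsilon$ for all $x,x'\in X$ and $d_H(\varphi(X),Y)<\epsilon$, where $d_H$ is the Hausdorff distance. For maps $f:X\to X$ and $g:Y\to Y$, the Arbieto–Morales $C^0$-Gromov–Hausdorff distance $D_{AM}(f,g)$ is the infimum of all $\epsilon>0$ for which there are $\epsilon$-isometries $\varphi:X\to Y$ and $\psi:Y\to X$ such that $$\sup_{x\in X}d\big(g(\varphi(x)),\varphi(f(x))\big)<\epsilon\quad\text{and}\quad\sup_{y\in Y}d\big(\psi(g(y)),f(\psi(y))\big)<\epsilon.$$ This depends only on the isometric conjugacy classes of $f$ and $g$, so $D_{AM}$ is defined on $\mathcal C\times\mathcal C$. **Theorem.** On $\mathcal C$, the metric $\tilde D$ and the quasi-distance $D_{AM}$ are topologically equivalent: the sets $A\subseteq\mathcal C$ that contain, around each of their points, a $\tilde D$-ball of positive radius (in $\mathcal C$) are exactly those that contain, around each of their points, a $D_{AM}$-ball of positive radius. Moreover: 1. $D_{AM}(\tilde f,\tilde g)\le 2\,\tilde D(\tilde f,\tilde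 g)$ for all $\tilde f,\tilde g\in\mathcal C$; 2. for every $\tilde g\in\mathcal C$ and every $\epsilon>0$ there is $\delta>0$ such that, for all $\tilde f\in\mathcal C$, $D_{AM}(\tilde f,\tilde g)<\delta$ implies $\tilde D(\tilde f,\tilde g)<\epsilon$. -/

import Mathlib

open Set TopologicalSpace

universe u

/-! ### Urysohn universal spaces -/

/-- Every isometry between two compact subsets extends to an isometry of the whole space. -/
def IsUltrahomogeneous (V : Type u) [MetricSpace V] : Prop :=
  ∀ A B : Set V, IsCompact A → IsCompact B → ∀ φ : A ≃ᵢ B,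
    ∃ Φ : V ≃ᵢ V, ∀ x : A, Φ (x : V) = (φ x : V)

/-- The space contains an isometric copy of every separable metric space. (A separable metric
space has at most continuum many points, so the choice of universe is immaterial.) -/
def IsUniversalMetric (V : Type u) [MetricSpace V] : Prop :=
  ∀ (X : Type u) [MetricSpace X] [SeparableSpace X], ∃ i : X → V, Isometry i

/-- Urysohn universal spaces: ultrahomogeneous, universal and Polish. -/
structure IsUrysohnUniversal (V : Type u) [MetricSpace V] : Prop where
  ultrahomogeneous : IsUltrahomogeneous V
  universal : IsUniversalMetric V
  polish : PolishSpace V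

/-! ### Dynamical systems and isometric conjugacy -/

/-- Dynamical systems in `V`: the nonempty compact relations `f ⊆ V × V` whose two projections
agree. -/
abbrev DS (V : Type u) [MetricSpace V] : Type u :=
  {f : NonemptyCompacts (V × V) // Prod.fst '' (f : Set (V × V)) = Prod.snd '' (f : Set (V × V))}

namespace DS

variable {V : Type u} [MetricSpace V]

/-- The relation itself. -/
def rel (f : DS V) : Set (V × V) := (f.1 : Set (V × V))

/-- The phase space `M(f)` of `f`. -/
def M (f : DS V) : Set V := Prod.fst '' f.rel

/-- The Hausdorff distance of the relations, for the max-metric on `V × V`. -/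
noncomputable def D (f g : DS V) : ℝ := Metric.hausdorffDist f.rel g.rel

/-- `f ∼ g`: there is an isometry `φ` of `M(f)` onto `M(g)` such that `φ⁻¹ g φ = f`. -/
def IsoConj (f g : DS V) : Prop :=
  ∃ φ : f.M ≃ᵢ g.M, ∀ x y : f.M, ((x : V), (y : V)) ∈ f.rel ↔ ((φ x : V), (φ y : V)) ∈ g.rel

theorem isoConj_equivalence : Equivalence (IsoConj (V := V)) where
  refl f := ⟨IsometryEquiv.refl _, fun _ _ => Iff.rfl⟩
  symm := by
    rintro f g ⟨φ, h⟩
    refine ⟨φ.symm, fun x y => ?_⟩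
    rw [h]
    simp
  trans := by
    rintro f g k ⟨φ, h⟩ ⟨ψ, h'⟩
    exact ⟨φ.trans ψ, fun x y => (h x y).trans (h' _ _)⟩

instance isoSetoid (V : Type u) [MetricSpace V] : Setoid (DS V) := ⟨IsoConj, isoConj_equivalence⟩

/-- `f` is the graph of the map `F : M(f) → M(f)`. -/
def IsGraph (f : DS V) (F : f.M → f.M) : Prop :=
  f.rel = Set.range fun x : f.M => ((x : V), (F x : V))

/-- `f` is a continuous map of its phase space. -/
def IsContinuousMap (f : DS V) : Prop := ∃ F : f.M → f.M, Continuous F ∧ f.IsGraph F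

end DS

/-- Dynamical systems modulo isometric conjugacy. -/
abbrev DSIso (V : Type u) [MetricSpace V] : Type u := Quotient (DS.isoSetoid V)

/-- The distance `D̃` on classes: the infimum of `D` over all representatives. -/
noncomputable def dTilde {V : Type u} [MetricSpace V] (a b : DSIso V) : ℝ :=
  sInf {r : ℝ | ∃ f g : DS V, Quotient.mk _ f = a ∧ Quotient.mk _ g = b ∧ r = DS.D f g}

/-- The continuous maps in `DSIso V`. -/
abbrev ContDSIso (V : Type u) [MetricSpace V] : Type u :=
  {a : DSIso V // ∃ f : DS V, Quotient.mk _ f = a ∧ f.IsContinuousMap}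

/-! ### The `C⁰`-Gromov–Hausdorff distance -/

section ArbietoMorales

variable {X Y : Type u} [MetricSpace X] [MetricSpace Y]

/-- The `C⁰`-distance of two maps (only used when `X` and `Y` are nonempty and compact, so that
the supremum is that of a nonempty bounded set). -/
noncomputable def c0Dist (f g : X → Y) : ℝ := ⨆ x, dist (f x) (g x)

/-- `φ` is an `ε`-isometry; no continuity is required (only used when `X` and `Y` are nonempty and
compact, so that the Hausdorff distance is that of nonempty bounded sets). -/
def IsEpsIsometry (ε : ℝ) (φ : X → Y) : Prop :=
  (∀ x x', |dist (φ x) (φ x') - dist x x'| < ε) ∧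
    Metric.hausdorffDist (Set.range φ) (Set.univ : Set Y) < ε

/-- The numbers `ε` admissible in the definition of the `C⁰`-Gromov–Hausdorff distance. -/
def IsAMClose (ε : ℝ) (F : X → X) (G : Y → Y) : Prop :=
  ∃ (φ : X → Y) (ψ : Y → X), IsEpsIsometry ε φ ∧ IsEpsIsometry ε ψ ∧
    c0Dist (G ∘ φ) (φ ∘ F) < ε ∧ c0Dist (ψ ∘ G) (F ∘ ψ) < ε

/-- The `C⁰`-Gromov–Hausdorff distance of Arbieto and Morales between self-maps of compact
metric spaces. -/
noncomputable def amDist (F : X → X) (G : Y → Y) : ℝ :=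
  sInf {ε : ℝ | 0 < ε ∧ IsAMClose ε F G}

end ArbietoMorales

/-- The `C⁰`-Gromov–Hausdorff distance on classes of continuous maps. By `dAM_mk` below, it is the
distance `amDist F G` of any representatives. -/
noncomputable def dAM {V : Type u} [MetricSpace V] (a b : ContDSIso V) : ℝ :=
  sInf {r : ℝ | ∃ (f g : DS V) (F : f.M → f.M) (G : g.M → g.M),
    Quotient.mk _ f = a.1 ∧ Quotient.mk _ g = b.1 ∧ f.IsGraph F ∧ g.IsGraph G ∧ r = amDist F G}

section Invariance

variable {X Y X' Y' : Type u} [MetricSpace X] [MetricSpace Y] [MetricSpace X'] [MetricSpace Y']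

theorem c0Dist_conj (e : X ≃ᵢ X') (e' : Y ≃ᵢ Y') (f g : X → Y) :
    c0Dist (e' ∘ f ∘ e.symm) (e' ∘ g ∘ e.symm) = c0Dist f g := by
  unfold c0Dist
  simp only [Function.comp_apply, e'.isometry.dist_eq]
  exact e.symm.toEquiv.surjective.iSup_comp (g := fun x => dist (f x) (g x))

theorem IsEpsIsometry.conj {ε : ℝ} {φ : X → Y} (h : IsEpsIsometry ε φ) (e : X ≃ᵢ X')
    (e' : Y ≃ᵢ Y') : IsEpsIsometry ε (e' ∘ φ ∘ e.symm) := by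
  refine ⟨fun x x' => ?_, ?_⟩
  · have := h.1 (e.symm x) (e.symm x')
    simpa only [Function.comp_apply, e'.isometry.dist_eq, e.symm.isometry.dist_eq] using this
  · have h1 : Set.range (e' ∘ φ ∘ e.symm) = e' '' Set.range φ := by
      rw [Set.range_comp, Set.range_comp φ, e.symm.surjective.range_eq, Set.image_univ]
    have h2 : (Set.univ : Set Y') = e' '' Set.univ := by
      rw [Set.image_univ, e'.surjective.range_eq]
    rw [h1, h2, Metric.hausdorffDist_image e'.isometry]
    exact h.2

theorem IsAMClose.conj {ε : ℝ} {F : X → X} {G : Y → Y} {F' : X' → X'} {G' : Y' → Y'}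
    (h : IsAMClose ε F G) (e : X ≃ᵢ X') (e' : Y ≃ᵢ Y') (hF : ∀ x, F' (e x) = e (F x))
    (hG : ∀ y, G' (e' y) = e' (G y)) : IsAMClose ε F' G' := by
  obtain ⟨φ, ψ, hφ, hψ, h1, h2⟩ := h
  have hF' : ∀ x, F (e.symm x) = e.symm (F' x) := fun x => by
    apply e.injective; rw [← hF]; simp
  have hG' : ∀ y, G (e'.symm y) = e'.symm (G' y) := fun y => by
    apply e'.injective; rw [← hG]; simp
  refine ⟨e' ∘ φ ∘ e.symm, e ∘ ψ ∘ e'.symm, hφ.conj e e', hψ.conj e' e, ?_, ?_⟩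
  · rw [← c0Dist_conj e e'] at h1
    convert h1 using 2 <;> funext x <;> simp [hF', hG]
  · rw [← c0Dist_conj e' e] at h2
    convert h2 using 2 <;> funext x <;> simp [hF, hG']

theorem amDist_conj {F : X → X} {G : Y → Y} {F' : X' → X'} {G' : Y' → Y'}
    (e : X ≃ᵢ X') (e' : Y ≃ᵢ Y') (hF : ∀ x, F' (e x) = e (F x))
    (hG : ∀ y, G' (e' y) = e' (G y)) : amDist F' G' = amDist F G := by
  unfold amDist
  congr 1
  ext ε
  refine and_congr_right fun _ => ⟨fun h => ?_, fun h => h.conj e e' hF hG⟩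
  refine h.conj e.symm e'.symm (fun x => ?_) fun y => ?_
  · apply e.injective; rw [← hF]; simp
  · apply e'.injective; rw [← hG]; simp

theorem DS.IsGraph.mem_iff {V : Type u} [MetricSpace V] {f : DS V} {F : f.M → f.M}
    (h : f.IsGraph F) (x y : f.M) : ((x : V), (y : V)) ∈ f.rel ↔ y = F x := by
  rw [show f.rel = _ from h]
  constructor
  · rintro ⟨z, hz⟩
    obtain ⟨h1, h2⟩ := Prod.ext_iff.1 hz
    obtain rfl : z = x := Subtype.ext h1
    exact Subtype.ext h2.symm
  · rintro rfl
    exact ⟨x, rfl⟩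

/-- The `C⁰`-Gromov–Hausdorff distance does not depend on the representatives. -/
theorem dAM_mk {V : Type u} [MetricSpace V] (a b : ContDSIso V) (f g : DS V)
    (F : f.M → f.M) (G : g.M → g.M) (hf : Quotient.mk _ f = a.1) (hg : Quotient.mk _ g = b.1)
    (hF : f.IsGraph F) (hG : g.IsGraph G) : dAM a b = amDist F G := by
  have key : ∀ (f f' : DS V) (F : f.M → f.M) (F' : f'.M → f'.M), f.IsGraph F → f'.IsGraph F' →
      (Quotient.mk _ f : DSIso V) = Quotient.mk _ f' →
      ∃ e : f.M ≃ᵢ f'.M, ∀ x, F' (e x) = e (F x) := by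
    intro f f' F F' hF hF' h
    obtain ⟨e, he⟩ : DS.IsoConj f f' := Quotient.exact h
    exact ⟨e, fun x => (((hF'.mem_iff _ _).1 ((he x (F x)).1 ((hF.mem_iff _ _).2 rfl)))).symm⟩
  unfold dAM
  refine Eq.trans (congrArg sInf ?_) (csInf_singleton (amDist F G))
  ext r
  constructor
  · rintro ⟨f', g', F', G', hf', hg', hF', hG', rfl⟩
    obtain ⟨e, he⟩ := key f f' F F' hF hF' (hf.trans hf'.symm)
    obtain ⟨e', he'⟩ := key g g' G G' hG hG' (hg.trans hg'.symm)
    exact amDist_conj e e' he he'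
  · rintro rfl
    exact ⟨f, g, F, G, hf, hg, hF, hG, rfl⟩

end Invariance

/-! ### The topology of a distance-like function -/

/-- The topology of a metric, or more generally of a quasi-distance `ρ`: a set is open when it
contains a `ρ`-ball around each of its points. -/
@[reducible]
def ballTopology {α : Type u} (ρ : α → α → ℝ) : TopologicalSpace α where
  IsOpen A := ∀ a ∈ A, ∃ r > 0, ∀ b, ρ b a < r → b ∈ A
  isOpen_univ := fun _ _ => ⟨1, one_pos, fun _ _ => trivial⟩
  isOpen_inter := by
    rintro A B hA hB a ⟨haA, haB⟩
    obtain ⟨r, hr, h⟩ := hA a haA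
    obtain ⟨s, hs, h'⟩ := hB a haB
    exact ⟨min r s, lt_min hr hs, fun b hb =>
      ⟨h b (hb.trans_le (min_le_left _ _)), h' b (hb.trans_le (min_le_right _ _))⟩⟩
  isOpen_sUnion := by
    rintro S hS a ⟨A, hAS, haA⟩
    obtain ⟨r, hr, h⟩ := hS A hAS a haA
    exact ⟨r, hr, fun b hb => ⟨A, hAS, h b hb⟩⟩

namespace DS

variable {V : Type u} [MetricSpace V]

/-! Both estimates compare graphs with almost-conjugacies. If the graphs of `F` and `G` are within
`r`, let `φ x` be the first coordinate of a point of `g` that is `r`-close to `(x, F x)`; the second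
coordinate is then `G (φ x)`, and triangle inequalities bound all the errors by `2 * r`
(`exists_isEpsIsometry_of_D_lt`). Conversely, an `ε`-isometry `φ` that almost intertwines `F` and
`G` lets one glue the two phase spaces, each `x` lying at distance `ε / 2` from `φ x`. Universality
embeds the result in `V`, where the copies of the two graphs are close (`exists_isoConj_D_le`). The
modulus of continuity of `G` enters only at points of `M(g)` missed by `φ`, so `δ` depends on `g`
alone. -/

theorem isCompact_rel (f : DS V) : IsCompact f.rel := f.1.isCompact

theorem nonempty_rel (f : DS V) : f.rel.Nonempty := f.1.nonempty

theorem hausdorffEDist_rel_ne_top (f g : DS V) : Metric.hausdorffEDist f.rel g.rel ≠ ⊤ :=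
  Metric.hausdorffEDist_ne_top_of_nonempty_of_bounded f.nonempty_rel g.nonempty_rel
    f.isCompact_rel.isBounded g.isCompact_rel.isBounded

instance compactSpace_M (f : DS V) : CompactSpace f.M :=
  isCompact_iff_compactSpace.1 (f.isCompact_rel.image continuous_fst)

instance nonempty_M (f : DS V) : Nonempty f.M :=
  (f.nonempty_rel.image Prod.fst).to_subtype

theorem M_eq_image_snd (f : DS V) : f.M = Prod.snd '' f.rel := f.2

theorem fst_mem_M {f : DS V} {p : V × V} (h : p ∈ f.rel) : p.1 ∈ f.M := ⟨p, h, rfl⟩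

theorem snd_mem_M {f : DS V} {p : V × V} (h : p ∈ f.rel) : p.2 ∈ f.M :=
  f.M_eq_image_snd ▸ ⟨p, h, rfl⟩

theorem IsGraph.mk_mem {f : DS V} {F : f.M → f.M} (hF : f.IsGraph F) (x : f.M) :
    ((x : V), (F x : V)) ∈ f.rel := (hF.mem_iff x (F x)).2 rfl

theorem IsGraph.exists_eq {f : DS V} {F : f.M → f.M} (hF : f.IsGraph F) {p : V × V}
    (hp : p ∈ f.rel) : ∃ x : f.M, p = ((x : V), (F x : V)) := by
  rw [show f.rel = _ from hF] at hp
  obtain ⟨x, rfl⟩ := hp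
  exact ⟨x, rfl⟩

/-- This is the condition that both projections agree, read on a graph. -/
theorem IsGraph.surjective {f : DS V} {F : f.M → f.M} (hF : f.IsGraph F) :
    Function.Surjective F := by
  intro y
  obtain ⟨p, hp, hpy⟩ : (y : V) ∈ Prod.snd '' f.rel := f.M_eq_image_snd ▸ y.2
  obtain ⟨x, rfl⟩ := hF.exists_eq hp
  exact ⟨x, Subtype.ext hpy⟩

/-- The infimum defining `dTilde` runs over all representatives, so each of them must be known to be
a continuous map. -/
theorem IsoConj.isContinuousMap {f g : DS V} (h : IsoConj f g) (hf : f.IsContinuousMap) :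
    g.IsContinuousMap := by
  obtain ⟨φ, hφ⟩ := h
  obtain ⟨F, hc, hF⟩ := hf
  refine ⟨φ ∘ F ∘ φ.symm, φ.continuous.comp (hc.comp φ.symm.continuous), ?_⟩
  have key : ∀ x y : g.M, ((x : V), (y : V)) ∈ g.rel ↔ y = φ (F (φ.symm x)) := fun x y => by
    have := hφ (φ.symm x) (φ.symm y)
    rw [φ.apply_symm_apply, φ.apply_symm_apply, hF.mem_iff] at this
    rw [← this, ← φ.symm.injective.eq_iff, φ.symm_apply_apply]
  ext p
  constructor
  · intro hp
    refine ⟨⟨p.1, fst_mem_M hp⟩, Prod.ext rfl ?_⟩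
    exact (congrArg Subtype.val ((key ⟨p.1, fst_mem_M hp⟩ ⟨p.2, snd_mem_M hp⟩).1 hp)).symm
  · rintro ⟨x, rfl⟩
    exact (key x _).2 rfl

/-! ### Isometric copies of a system -/

/-- The isometric copy in `V` of a continuous surjection of a nonempty compact space. -/
def ofMap {X : Type u} [MetricSpace X] [CompactSpace X] [Nonempty X] (F : X → X)
    (hc : Continuous F) (hs : Function.Surjective F) (i : X → V) (hi : Isometry i) : DS V :=
  ⟨⟨⟨Set.range fun x => (i x, i (F x)),
      isCompact_range (hi.continuous.prodMk (hi.continuous.comp hc))⟩, Set.range_nonempty _⟩, by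
    change Prod.fst '' (Set.range fun x => (i x, i (F x))) =
      Prod.snd '' (Set.range fun x => (i x, i (F x)))
    rw [← Set.range_comp, ← Set.range_comp]
    exact (hs.range_comp i).symm⟩

section ofMap

variable {X : Type u} [MetricSpace X] [CompactSpace X] [Nonempty X] (F : X → X)
  (hc : Continuous F) (hs : Function.Surjective F) (i : X → V) (hi : Isometry i)

theorem ofMap_rel : (ofMap F hc hs i hi).rel = Set.range fun x => (i x, i (F x)) := rfl

theorem ofMap_M : (ofMap F hc hs i hi).M = Set.range i := by
  rw [M, ofMap_rel, ← Set.range_comp]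
  rfl

end ofMap

theorem IsGraph.isoConj_ofMap {f : DS V} {F : f.M → f.M} (hF : f.IsGraph F) (hc : Continuous F)
    (i : f.M → V) (hi : Isometry i) : IsoConj f (ofMap F hc hF.surjective i hi) := by
  let j : f.M → (ofMap F hc hF.surjective i hi).M := fun x =>
    ⟨i x, (ofMap_M F hc hF.surjective i hi).symm ▸ ⟨x, rfl⟩⟩
  have hj : Isometry j := fun x y => hi x y
  have hjs : Function.Surjective j := by
    rintro ⟨y, hy⟩
    obtain ⟨x, hx⟩ : y ∈ Set.range i := ofMap_M F hc hF.surjective i hi ▸ hy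
    exact ⟨x, Subtype.ext hx⟩
  refine ⟨⟨Equiv.ofBijective j ⟨hj.injective, hjs⟩, hj⟩, fun x y => ?_⟩
  change _ ↔ (i x, i y) ∈ Set.range fun x => (i x, i (F x))
  rw [hF.mem_iff]
  constructor
  · rintro rfl
    exact ⟨x, rfl⟩
  · rintro ⟨z, hz⟩
    obtain ⟨h1, h2⟩ := Prod.ext_iff.1 hz
    obtain rfl := hi.injective h1
    exact (hi.injective h2).symm

/-! ### Close graphs and almost-conjugacies -/

theorem exists_isEpsIsometry_of_D_lt {f g : DS V} {F : f.M → f.M} {G : g.M → g.M}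
    (hF : f.IsGraph F) (hG : g.IsGraph G) {r s : ℝ} (hr : D f g < r) (hs : 2 * r < s) :
    ∃ φ : f.M → g.M, IsEpsIsometry s φ ∧ c0Dist (G ∘ φ) (φ ∘ F) < s := by
  have hr0 : 0 < r := Metric.hausdorffDist_nonneg.trans_lt hr
  -- One point of `g` near `(x, F x)` controls both `φ x` and `G (φ x)`, because the product carries
  -- the max-metric.
  have h1 : ∀ x : f.M, ∃ y : g.M, dist (x : V) y < r ∧ dist (F x : V) (G y) < r := fun x => by
    obtain ⟨q, hq, hd⟩ := Metric.exists_dist_lt_of_hausdorffDist_lt (hF.mk_mem x) hr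
      (hausdorffEDist_rel_ne_top f g)
    obtain ⟨y, rfl⟩ := hG.exists_eq hq
    exact ⟨y, max_lt_iff.1 hd⟩
  have h2 : ∀ y : g.M, ∃ x : f.M, dist (x : V) y < r := fun y => by
    obtain ⟨q, hq, hd⟩ := Metric.exists_dist_lt_of_hausdorffDist_lt' (hG.mk_mem y) hr
      (hausdorffEDist_rel_ne_top f g)
    obtain ⟨x, rfl⟩ := hF.exists_eq hq
    exact ⟨x, (max_lt_iff.1 hd).1⟩
  choose φ hφ hφ' using h1
  refine ⟨φ, ⟨fun x x' => ?_, ?_⟩, ?_⟩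
  · have e1 : dist (φ x) (φ x') = dist (φ x : V) (φ x') := rfl
    have e2 : dist x x' = dist (x : V) x' := rfl
    have a := hφ x
    have b := hφ x'
    have c := dist_triangle4 (x : V) (φ x) (φ x') x'
    have d := dist_triangle4 (φ x : V) x x' (φ x')
    rw [dist_comm (φ x' : V)] at c
    rw [dist_comm (φ x : V) x] at d
    rw [e1, e2, abs_lt]
    constructor <;> linarith
  · refine (Metric.hausdorffDist_le_of_mem_dist (r := 2 * r) (by positivity)
      (fun y _ => ⟨y, trivial, by simp [hr0.le]⟩) fun y _ => ?_).trans_lt hs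
    obtain ⟨x, hx⟩ := h2 y
    refine ⟨φ x, ⟨x, rfl⟩, ?_⟩
    change dist (y : V) (φ x) ≤ _
    have := dist_triangle_left (y : V) (φ x) x
    linarith [hφ x]
  · refine (ciSup_le fun x => ?_).trans_lt hs
    change dist (G (φ x) : V) (φ (F x)) ≤ _
    have := dist_triangle_left (G (φ x) : V) (φ (F x)) (F x)
    linarith [hφ (F x), hφ' x]

theorem isAMClose_of_D_lt {f g : DS V} {F : f.M → f.M} {G : g.M → g.M}
    (hF : f.IsGraph F) (hG : g.IsGraph G) {s : ℝ} (hs : 2 * D f g < s) : IsAMClose s F G := by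
  obtain ⟨r, hr, hrs⟩ := exists_between (show D f g < s / 2 by linarith)
  obtain ⟨φ, h1, h2⟩ := exists_isEpsIsometry_of_D_lt hF hG hr (s := s) (by linarith)
  obtain ⟨ψ, h3, h4⟩ := exists_isEpsIsometry_of_D_lt hG hF (r := r) (s := s)
    (by rwa [D, Metric.hausdorffDist_comm]) (by linarith)
  refine ⟨φ, ψ, h1, h3, h2, ?_⟩
  simpa only [c0Dist, dist_comm] using h4

theorem amDist_le_two_mul_D {f g : DS V} {F : f.M → f.M} {G : g.M → g.M}
    (hF : f.IsGraph F) (hG : g.IsGraph G) : amDist F G ≤ 2 * D f g := by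
  refine le_of_forall_gt fun s hs => ?_
  obtain ⟨t, ht, hts⟩ := exists_between hs
  refine lt_of_le_of_lt (csInf_le ⟨0, fun _ h => h.1.le⟩ ⟨?_, isAMClose_of_D_lt hF hG ht⟩) hts
  exact lt_of_le_of_lt (mul_nonneg two_pos.le Metric.hausdorffDist_nonneg) ht

theorem exists_isAMClose_of_amDist_lt {f g : DS V} {F : f.M → f.M} {G : g.M → g.M}
    (hF : f.IsGraph F) (hG : g.IsGraph G) {δ : ℝ} (h : amDist F G < δ) :
    ∃ ε, 0 < ε ∧ ε < δ ∧ IsAMClose ε F G := by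
  -- Over an empty set the infimum would take the default value 0 and yield no admissible `ε`.
  have hne : {ε : ℝ | 0 < ε ∧ IsAMClose ε F G}.Nonempty :=
    ⟨2 * D f g + 1, add_pos_of_nonneg_of_pos (mul_nonneg two_pos.le Metric.hausdorffDist_nonneg)
      one_pos, isAMClose_of_D_lt hF hG (lt_add_one _)⟩
  obtain ⟨ε, ⟨h0, hε⟩, hlt⟩ := exists_lt_of_csInf_lt hne h
  exact ⟨ε, h0, hlt, hε⟩

/-- Systems which are close by means of an `ε`-isometry have conjugates which are close. -/
theorem exists_isoConj_D_le (hV : IsUniversalMetric V) {f g : DS V} {F : f.M → f.M}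
    {G : g.M → g.M} (hF : f.IsGraph F) (hG : g.IsGraph G) (hFc : Continuous F)
    (hGc : Continuous G) {ε η : ℝ} (hε : 0 < ε) (hεη : 2 * ε ≤ η)
    (hη : ∀ y y', dist y y' < ε → dist (G y) (G y') ≤ η) {φ : f.M → g.M}
    (hφ : IsEpsIsometry ε φ) (hφc : c0Dist (G ∘ φ) (φ ∘ F) < ε) :
    ∃ f' g' : DS V, IsoConj f f' ∧ IsoConj g g' ∧ D f' g' ≤ 2 * η := by
  let _ : MetricSpace (f.M ⊕ g.M) := Metric.glueMetricApprox id φ (ε / 2) (half_pos hε)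
    fun x x' => by
      rw [abs_sub_comm]
      exact (hφ.1 x x').le.trans (by linarith)
  obtain ⟨i, hi⟩ := hV (f.M ⊕ g.M)
  have hl : Isometry (i ∘ Sum.inl) := hi.comp (Isometry.of_dist_eq fun _ _ => rfl)
  have hr : Isometry (i ∘ Sum.inr) := hi.comp (Isometry.of_dist_eq fun _ _ => rfl)
  have hd : ∀ x y, dist (i (.inl x)) (i (.inr y)) ≤ ε / 2 + dist (φ x) y := fun x y => by
    have h1 : dist (i (.inl x)) (i (.inr (φ x))) = ε / 2 :=
      (hi.dist_eq _ _).trans (Metric.glueDist_glued_points id φ (ε / 2) x)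
    have h2 : dist (i (.inr (φ x))) (i (.inr y)) = dist (φ x) y := hr.dist_eq _ _
    linarith [dist_triangle (i (.inl x)) (i (.inr (φ x))) (i (.inr y))]
  have hc : ∀ x, dist (φ (F x)) (G (φ x)) < ε := fun x => by
    rw [dist_comm]
    -- The supremum bounds each term only if it is finite, which compactness of `M(g)` ensures.
    refine lt_of_le_of_lt (le_ciSup (f := fun x => dist ((G ∘ φ) x) ((φ ∘ F) x)) ?_ x) hφc
    refine ⟨Metric.diam (univ : Set g.M), ?_⟩
    rintro _ ⟨x, rfl⟩
    exact Metric.dist_le_diam_of_mem isCompact_univ.isBounded trivial trivial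
  refine ⟨_, _, hF.isoConj_ofMap hFc _ hl, hG.isoConj_ofMap hGc _ hr,
    Metric.hausdorffDist_le_of_mem_dist (by linarith) ?_ ?_⟩
  · rintro _ ⟨x, rfl⟩
    refine ⟨_, ⟨φ x, rfl⟩, max_le ?_ ?_⟩
    · have := hd x (φ x)
      rw [dist_self] at this
      exact this.trans (by linarith)
    · exact (hd (F x) (G (φ x))).trans (by linarith [hc x])
  · rintro _ ⟨y, rfl⟩
    obtain ⟨_, ⟨x, rfl⟩, hx⟩ := Metric.exists_dist_lt_of_hausdorffDist_lt' (mem_univ y) hφ.2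
      (Metric.hausdorffEDist_ne_top_of_nonempty_of_bounded (range_nonempty φ) univ_nonempty
        (isCompact_univ.isBounded.subset (subset_univ _)) isCompact_univ.isBounded)
    refine ⟨_, ⟨x, rfl⟩, ?_⟩
    rw [dist_comm]
    refine max_le ?_ ?_
    · exact (hd x y).trans (by linarith)
    · refine (hd (F x) (G y)).trans ?_
      -- The total is at most `ε / 2 + ε + η`, within `2 * η` since `2 * ε ≤ η`.
      linarith [hc x, hη _ _ hx, dist_triangle (φ (F x)) (G (φ x)) (G y)]

end DS

/-! ### Passage to conjugacy classes -/

section Classes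

variable {V : Type u} [MetricSpace V]

theorem dTilde_mk_le_D (f g : DS V) :
    dTilde (Quotient.mk _ f : DSIso V) (Quotient.mk _ g) ≤ DS.D f g := by
  refine csInf_le ⟨0, ?_⟩ ⟨f, g, rfl, rfl, rfl⟩
  rintro _ ⟨f, g, -, -, rfl⟩
  exact Metric.hausdorffDist_nonneg

theorem ContDSIso.isContinuousMap_of_mk_eq (a : ContDSIso V) {f : DS V}
    (h : Quotient.mk _ f = a.1) : f.IsContinuousMap := by
  obtain ⟨f₀, h₀, hf₀⟩ := a.2
  have hc : DS.IsoConj f₀ f := Quotient.exact (h₀.trans h.symm)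
  exact hc.isContinuousMap hf₀

theorem dAM_le_two_mul_dTilde (a b : ContDSIso V) : dAM a b ≤ 2 * dTilde a.1 b.1 := by
  suffices h : dAM a b / 2 ≤ dTilde a.1 b.1 by linarith
  -- These representatives only show that the infimum is over a nonempty set.
  obtain ⟨f, hf⟩ := Quotient.exists_rep a.1
  obtain ⟨g, hg⟩ := Quotient.exists_rep b.1
  refine le_csInf ⟨_, f, g, hf, hg, rfl⟩ ?_
  rintro _ ⟨f, g, hf, hg, rfl⟩
  obtain ⟨F, -, hF⟩ := a.isContinuousMap_of_mk_eq hf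
  obtain ⟨G, -, hG⟩ := b.isContinuousMap_of_mk_eq hg
  rw [dAM_mk a b f g F G hf hg hF hG]
  linarith [DS.amDist_le_two_mul_D hF hG]

theorem exists_dTilde_lt_of_dAM_lt (hV : IsUniversalMetric V) (b : ContDSIso V) {ε : ℝ}
    (hε : 0 < ε) : ∃ δ : ℝ, 0 < δ ∧ ∀ a : ContDSIso V, dAM a b < δ → dTilde a.1 b.1 < ε := by
  obtain ⟨g, hg, G, hGc, hG⟩ := b.2
  obtain ⟨δ, hδ, hGδ⟩ := Metric.uniformContinuous_iff.1
    (CompactSpace.uniformContinuous_of_continuous hGc) (ε / 3) (by positivity)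
  -- The bound `ε / 6` gives `2 * s ≤ η` with `η = ε / 3`, and the final distance is at most `2 * η
  -- < ε`.
  refine ⟨min δ (ε / 6), lt_min hδ (by positivity), fun a hab => ?_⟩
  obtain ⟨f, hf, F, hFc, hF⟩ := a.2
  rw [dAM_mk a b f g F G hf hg hF hG] at hab
  obtain ⟨s, hs, hsδ, φ, -, hφ, -, hφc, -⟩ := DS.exists_isAMClose_of_amDist_lt hF hG hab
  have h1 := hsδ.trans_le (min_le_left _ _)
  have h2 := hsδ.trans_le (min_le_right _ _)
  obtain ⟨f', g', hf', hg', hD⟩ := DS.exists_isoConj_D_le hV hF hG hFc hGc (η := ε / 3) hs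
    (by linarith) (fun y y' hy => (hGδ (hy.trans h1)).le) hφ hφc
  rw [← hf, ← hg, show (Quotient.mk _ f : DSIso V) = Quotient.mk _ f' from Quotient.sound hf',
    show (Quotient.mk _ g : DSIso V) = Quotient.mk _ g' from Quotient.sound hg']
  linarith [dTilde_mk_le_D f' g']

end Classes

theorem mainTheorem5 {U : Type u} [MetricSpace U] (hU : IsUrysohnUniversal U) :
    ballTopology (fun a b : ContDSIso U => dTilde a.1 b.1) =
        ballTopology (fun a b : ContDSIso U => dAM a b) ∧
      (∀ a b : ContDSIso U, dAM a b ≤ 2 * dTilde a.1 b.1) ∧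
      (∀ (b : ContDSIso U) (ε : ℝ), 0 < ε → ∃ δ : ℝ, 0 < δ ∧
        ∀ a : ContDSIso U, dAM a b < δ → dTilde a.1 b.1 < ε) := by
  refine ⟨?_, dAM_le_two_mul_dTilde, fun b ε hε => exists_dTilde_lt_of_dAM_lt hU.universal b hε⟩
  -- Balls have their centre in the second argument, so a `δ` depending on that argument is enough.
  refine TopologicalSpace.ext_iff.2 fun A => ⟨fun hA a ha => ?_, fun hA a ha => ?_⟩
  · obtain ⟨r, hr, h⟩ := hA a ha
    obtain ⟨δ, hδ, h'⟩ := exists_dTilde_lt_of_dAM_lt hU.universal a hr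
    exact ⟨δ, hδ, fun b hb => h b (h' b hb)⟩
  · obtain ⟨r, hr, h⟩ := hA a ha
    refine ⟨r / 2, half_pos hr, fun b hb => h b ?_⟩
    linarith [dAM_le_two_mul_dTilde b a]
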